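/- Let $r, j, m$ be positive integers with $j \le m$ and $rm \ge 2$, and let $K$ be an algebraic number field of degree $n$ over $\mathbb{Q}$ with ring of integers $\mathcal{O}$. Call an $m$-tuple $(\beta_1,\dots,\beta_m)\in\mathcal{O}^m$ *$j$-wise relatively $r$-prime* if for any $j$ distinct indices $i_1,\dots,i_j$ there is no prime ideal $\mathfrak{p}$ of $\mathcal{O}$ with $\mathfrak{p}^r \mid \langle \beta_{i_1},\dots,\beta_{i_j}\rangle$; equivalently, it is $H$-wise relatively $r$-prime for $H = K_m^{(j)}$, the complete $j$-uniform hypergraph on $m$ vertices. For an integral basis $\mathcal{B}=\{\alpha_1,\dots,\alpha_n\}$ of $\mathcal{O}$ and a real number $M>0$ put $$\mathcal{O}_{\mathcal{B}}[M]=\Big\{\sum_{i=1}^n c_i\alpha_i : c_i\in[-M,M)\cap\mathbb{Z}\Big\},$$ and say that a set $T\subseteq\mathcal{O}^m$ has *density* $d$ if for every integral basis $\mathcal{B}$ of $\mathcal{O}$ $$\limsup_{M\to\infty}\frac{|T\cap\mathcal{O}_{\mathcal{B}}[M]^m|}{|\mathcal{O}_{\mathcal{B}}[M]^m|}=\liminf_{M\to\infty}\frac{|T\cap\mathcal{O}_{\mathcal{B}}[M]^m|}{|\mathcal{O}_{\mathcal{B}}[M]^m|}=d.$$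 Then the set of $j$-wise relatively $r$-prime $m$-tuples of elements of $\mathcal{O}$ has density $$\prod_{\mathfrak{p}}\Big[\sum_{k=0}^{j-1}\binom{m}{k}\Big(1-\frac{1}{\mathfrak{N}(\mathfrak{p}^r)}\Big)^{m-k}\Big(\frac{1}{\mathfrak{N}(\mathfrak{p}^r)}\Big)^{k}\Big],$$ where $\mathfrak{N}(\mathfrak{a})=|\mathcal{O}/\mathfrak{a}|$ and the product, taken over all nonzero prime ideals $\mathfrak{p}$ of $\mathcal{O}$, converges unconditionally (its value may be $0$, as happens for $r=j=1$). -/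

import Mathlib

open Filter Module NumberField

/-- The family `β` of elements of the Dedekind domain `D` is relatively `r`-prime: no `r`-th power
of a prime ideal divides the ideal generated by the members of the family. -/
def RelativelyRPrime {D : Type*} [CommRing D] [IsDedekindDomain D] (r : ℕ) {ι : Type*}
    (β : ι → D) : Prop :=
  ∀ 𝔭 : Ideal D, 𝔭.IsPrime → ¬ 𝔭 ^ r ∣ Ideal.span (Set.range β)

/-- The tuple `β`, whose entries label the vertices of the hypergraph `H`, is `H`-wise relatively
`r`-prime: the entries on each hyperedge of `H` are relatively `r`-prime. -/
def HypergraphWiseRelativelyRPrime {D : Type*} [CommRing D] [IsDedekindDomain D] {V : Type*}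
    (H : Hypergraph V) (r : ℕ) (β : V → D) : Prop :=
  ∀ e ∈ H.edgeSet, RelativelyRPrime r (fun i : e => β i)

/-- The complete `j`-uniform hypergraph `K_m^{(j)}` on the `m` vertices `Fin m`: its hyperedges are
all the sets of exactly `j` vertices. -/
def completeUniformHypergraph (m j : ℕ) : Hypergraph (Fin m) where
  vertexSet := Set.univ
  edgeSet := {e | e.encard = j}
  subset_vertexSet_of_mem_edgeSet' := fun e _ => Set.subset_univ e

/-- The `m`-tuple `β` is `j`-wise relatively `r`-prime: any `j` of its entries are relatively
`r`-prime. -/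
def JWiseRelativelyRPrime {D : Type*} [CommRing D] [IsDedekindDomain D] {m : ℕ} (j r : ℕ)
    (β : Fin m → D) : Prop :=
  HypergraphWiseRelativelyRPrime (completeUniformHypergraph m j) r β

section Density

variable {K : Type*} [Field K] [NumberField K] {ι : Type*} {m : ℕ}

/-- `𝒪_ℬ[M]`: the algebraic integers all of whose coordinates in the integral basis `B` lie in
`[-M, M) ∩ ℤ`. -/
def integralBox (B : Basis ι ℤ (𝓞 K)) (M : ℝ) : Set (𝓞 K) :=
  {x | ∀ i, (B.repr x i : ℝ) ∈ Set.Ico (-M) M}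

/-- `𝒪_ℬ[M]^m`, as a set of `m`-tuples. -/
def integralBoxTuples (B : Basis ι ℤ (𝓞 K)) (m : ℕ) (M : ℝ) : Set (Fin m → 𝓞 K) :=
  {z | ∀ i, z i ∈ integralBox B M}

/-- The proportion `|T ∩ 𝒪_ℬ[M]^m| / |𝒪_ℬ[M]^m|`. -/
noncomputable def boxRatio (B : Basis ι ℤ (𝓞 K)) (T : Set (Fin m → 𝓞 K)) (M : ℝ) : ℝ :=
  ((T ∩ integralBoxTuples B m M).ncard : ℝ) / ((integralBoxTuples B m M).ncard : ℝ)

/-- The upper density of `T` with respect to the integral basis `B`. The ratios lie in `[0, 1]`, so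
this is a genuine limit superior. -/
noncomputable def upperDensityWrt (B : Basis ι ℤ (𝓞 K)) (T : Set (Fin m → 𝓞 K)) : ℝ :=
  limsup (fun M : ℝ => boxRatio B T M) atTop

/-- The lower density of `T` with respect to the integral basis `B`. -/
noncomputable def lowerDensityWrt (B : Basis ι ℤ (𝓞 K)) (T : Set (Fin m → 𝓞 K)) : ℝ :=
  liminf (fun M : ℝ => boxRatio B T M) atTop

/-- `T` has density `d` with respect to the integral basis `B`. -/
def HasDensityWrt (B : Basis ι ℤ (𝓞 K)) (T : Set (Fin m → 𝓞 K)) (d : ℝ) : Prop :=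
  upperDensityWrt B T = d ∧ lowerDensityWrt B T = d

/-- `T` has density `d`: with respect to every integral basis of `𝓞 K` (each consists of
`[K : ℚ]` elements), the density of `T` exists and is equal to `d`. -/
def HasDensity (T : Set (Fin m → 𝓞 K)) (d : ℝ) : Prop :=
  ∀ B : Basis (Fin (finrank ℚ K)) ℤ (𝓞 K), HasDensityWrt B T d

end Density

/-- The factor of the density at the nonzero prime ideal `𝔭`, namely
`∑_{k=0}^{j-1} C(m,k) (1 - 1/𝔑(𝔭^r))^{m-k} (1/𝔑(𝔭^r))^k`. -/
noncomputable def localFactor {K : Type*} [Field K] [NumberField K] (r j m : ℕ)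
    (𝔭 : IsDedekindDomain.HeightOneSpectrum (𝓞 K)) : ℝ :=
  ∑ k ∈ Finset.range j, (m.choose k : ℝ)
    * (1 - 1 / (Ideal.absNorm (𝔭.asIdeal ^ r) : ℝ)) ^ (m - k)
    * (1 / (Ideal.absNorm (𝔭.asIdeal ^ r) : ℝ)) ^ k

/-! ### Sums over ideals and the vanishing Euler product -/

section IdealSums

open IsDedekindDomain Topology

variable (K : Type*) [Field K] [NumberField K]

/-! Whether an entry lies in 𝔭^r depends only on its residue, and residues modulo finitely many
coprime ideals are equidistributed in large boxes and independent by the Chinese remainder theorem.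
So the conditions at a finite set S of primes have as density the product of their local factors
(`tendsto_boxRatio_finset`). Letting S grow bounds the upper density by the infinite product.

For the lower density, tuples failing at a prime outside S must be rare, uniformly in the box. A box
Q with a nonzero element of an ideal I contains O(|Q| / N(I)) elements of I
(`exists_card_coordBox_filter_mem_ideal_le`), so j given entries all lie in 𝔭^r with proportion
O(N(𝔭)^(-rj)); at the remaining primes those entries must all be 0. If rj ≥ 2, convergence of ∑
N(𝔭)^(-2) makes the tail small (`exists_boxRatio_tail_le`). If r = j = 1, divergence of ∑ 1/N(I)
forces the product to be 0, and the lower bound is trivial. -/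

theorem sum_card_absNorm_eq_div_tendsto :
    ∃ κ : ℝ, 0 < κ ∧ Tendsto (fun n : ℕ ↦
      (∑ k ∈ Finset.Icc 1 n, (Nat.card {I : Ideal (𝓞 K) // Ideal.absNorm I = k} : ℝ)) / n)
        atTop (𝓝 κ) := by
  refine ⟨_, dedekindZeta_residue_pos K, ?_⟩
  rw [dedekindZeta_residue_def]
  refine ((Ideal.tendsto_norm_le_div_atTop₀ K).comp tendsto_natCast_atTop_atTop).congr fun n ↦ ?_
  simp only [Function.comp_apply, Nat.cast_le, ← Nat.cast_sum]
  congr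
  -- The added 1 accounts for the zero ideal, the only one of norm 0.
  rw [← add_left_inj 1, ← Ideal.card_norm_le_eq_card_norm_le_add_one,
    show Finset.Icc 1 n = Finset.Ioc 0 n from Finset.Icc_succ_left_eq_Ioc _ _,
    show 1 = Nat.card {I : Ideal (𝓞 K) // Ideal.absNorm I = 0} by
      simp [Ideal.absNorm_eq_zero_iff],
    Finset.sum_Ioc_add_eq_sum_Icc (n.zero_le),
    ← Finset.card_preimage_eq_sum_card_image_eq (fun k _ ↦ Ideal.finite_setOfPred_absNorm_eq k)]
  simp [Set.coe_eq_subtype]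

/-- Grouped by norm, this is the Dedekind zeta series at 2; ideal counts growing linearly make it
converge. The zero ideal contributes `0⁻¹ = 0`. -/
theorem summable_absNorm_sq_inv :
    Summable fun I : Ideal (𝓞 K) ↦ ((Ideal.absNorm I : ℝ) ^ 2)⁻¹ := by
  obtain ⟨κ, -, h⟩ := sum_card_absNorm_eq_div_tendsto K
  have hO : (fun n : ℕ ↦ ∑ k ∈ Finset.Icc 1 n,
      (Nat.card {I : Ideal (𝓞 K) // Ideal.absNorm I = k} : ℝ)) =O[atTop]
        fun n ↦ (n : ℝ) ^ (1 : ℝ) := by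
    simp only [Real.rpow_one]
    refine Asymptotics.isBigO_of_div_tendsto_nhds ?_ κ h
    filter_upwards [eventually_gt_atTop 0] with n hn h0
    exact absurd h0 (by positivity)
  have hs := LSeriesSummable_of_sum_norm_bigO_and_nonneg hO (fun _ ↦ by positivity) zero_le_one
    (s := 2) (by simp)
  rw [LSeriesSummable, ← summable_norm_iff] at hs
  rw [← (Equiv.sigmaFiberEquiv fun I : Ideal (𝓞 K) ↦ Ideal.absNorm I).summable_iff,
    summable_sigma_of_nonneg (fun _ ↦ by simp)]
  have hfin (n : ℕ) : Finite {I : Ideal (𝓞 K) // Ideal.absNorm I = n} :=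
    (Ideal.finite_setOfPred_absNorm_eq n).to_subtype
  refine ⟨fun n ↦ Summable.of_finite, hs.congr fun n ↦ ?_⟩
  have : ∀ I : {I : Ideal (𝓞 K) // Ideal.absNorm I = n},
      ((fun I : Ideal (𝓞 K) ↦ ((Ideal.absNorm I : ℝ) ^ 2)⁻¹) ∘
        (Equiv.sigmaFiberEquiv fun I : Ideal (𝓞 K) ↦ Ideal.absNorm I)) ⟨n, I⟩
        = ((n : ℝ) ^ 2)⁻¹ := fun I ↦ by
    simp [Equiv.sigmaFiberEquiv, I.2]
  simp only [this, tsum_const, nsmul_eq_mul]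
  rw [LSeries.term_def]
  split_ifs with hn
  · simp [hn]
  · simp [div_eq_mul_inv]

/-- The number of nonzero ideals of norm at most s, divided by s, is a sum of terms 1/s dominated by
1/N(I), each tending to 0. Summability would force the limit 0, but the limit is the positive
residue. -/
theorem not_summable_absNorm_inv :
    ¬ Summable fun I : Ideal (𝓞 K) ↦ (Ideal.absNorm I : ℝ)⁻¹ := by
  intro hs
  have h1 := Ideal.tendsto_norm_le_div_atTop₀ K
  have h2 : Tendsto (fun s : ℝ ↦ ∑' I : Ideal (𝓞 K),
      if I ≠ 0 ∧ (Ideal.absNorm I : ℝ) ≤ s then s⁻¹ else 0) atTop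
        (𝓝 (∑' _ : Ideal (𝓞 K), (0 : ℝ))) := by
    refine tendsto_tsum_of_dominated_convergence hs (fun I ↦ ?_) ?_
    · refine squeeze_zero' ?_ ?_ tendsto_inv_atTop_zero
      all_goals
        filter_upwards [eventually_ge_atTop 0] with s hs
        split_ifs <;> simp [hs]
    · filter_upwards [eventually_gt_atTop 0] with s hs I
      split_ifs with h
      · rw [Real.norm_of_nonneg (by positivity)]
        have : 0 < Ideal.absNorm I := by
          rw [Nat.pos_iff_ne_zero, Ne, Ideal.absNorm_eq_zero_iff]; exact h.1
        exact inv_anti₀ (by positivity) h.2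
      · simp
  have h3 := h1.congr' (f₂ := fun s : ℝ ↦ ∑' I : Ideal (𝓞 K),
      if I ≠ 0 ∧ (Ideal.absNorm I : ℝ) ≤ s then s⁻¹ else 0) ?_
  · rw [tsum_zero] at h2
    have := tendsto_nhds_unique h2 h3
    rw [← dedekindZeta_residue_def] at this
    exact (dedekindZeta_residue_pos K).ne this
  · filter_upwards [eventually_gt_atTop 0] with s hs
    have := tsum_subtype {I : Ideal (𝓞 K) | I ≠ 0 ∧ (Ideal.absNorm I : ℝ) ≤ s} fun _ ↦ s⁻¹
    simp only [Set.indicator_apply, Set.mem_ofPred_eq, tsum_const, nsmul_eq_mul] at this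
    rw [← this, div_eq_mul_inv]
    congr 2
    refine Nat.card_congr ((Equiv.subtypeSubtypeEquivSubtypeInter
      (· ∈ nonZeroDivisors (Ideal (𝓞 K))) fun I ↦ (Ideal.absNorm I : ℝ) ≤ s).trans
      (Equiv.subtypeEquivRight fun I ↦ ?_))
    rw [mem_nonZeroDivisors_iff_ne_zero]
    rfl

open scoped Classical in
-- Unique factorization embeds A into the exponent vectors on S, the primes dividing some member of
-- A; expanding the truncated Euler product yields one term for each vector.
theorem sum_absNorm_inv_le_prod (A : Finset (Ideal (𝓞 K))) (hA : ∀ I ∈ A, I ≠ 0) :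
    ∃ S : Finset (HeightOneSpectrum (𝓞 K)), ∑ I ∈ A, (Ideal.absNorm I : ℝ)⁻¹ ≤
      ∏ 𝔭 ∈ S, (1 - (Ideal.absNorm 𝔭.asIdeal : ℝ)⁻¹)⁻¹ := by
  let v (I : Ideal (𝓞 K)) (𝔭 : HeightOneSpectrum (𝓞 K)) : ℕ :=
    (Associates.mk 𝔭.asIdeal).count (Associates.mk I).factors
  have hfac {I : Ideal (𝓞 K)} (hI : I ≠ 0) := Ideal.finite_factors hI
  let F (I : Ideal (𝓞 K)) : Finset (HeightOneSpectrum (𝓞 K)) :=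
    if hI : I ≠ 0 then (hfac hI).toFinset else ∅
  let S := A.biUnion F
  have hprod : ∀ I ∈ A, ∏ 𝔭 ∈ S, 𝔭.asIdeal ^ v I 𝔭 = I := fun I hI ↦ by
    rw [← finprod_eq_prod_of_mulSupport_subset]
    · exact Ideal.finprod_heightOneSpectrum_factorization (hA I hI)
    · intro 𝔭 h𝔭
      have h0 : v I 𝔭 ≠ 0 := fun h ↦ h𝔭 (by simp [h])
      have := (Associates.count_ne_zero_iff_dvd (hA I hI) 𝔭.irreducible).1 h0
      simp only [S, Finset.coe_biUnion, Set.mem_iUnion]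
      refine ⟨I, hI, ?_⟩
      dsimp only [F]
      rw [dif_pos (hA I hI)]
      simpa using this
  let k := (A.sup fun I ↦ S.sup (v I)) + 1
  refine ⟨S, ?_⟩
  calc ∑ I ∈ A, (Ideal.absNorm I : ℝ)⁻¹
      = ∑ I ∈ A, ∏ 𝔭 ∈ S.attach, ((Ideal.absNorm 𝔭.1.asIdeal : ℝ)⁻¹) ^ v I 𝔭.1 := by
        refine Finset.sum_congr rfl fun I hI ↦ ?_
        rw [Finset.prod_attach S fun 𝔭 ↦ ((Ideal.absNorm 𝔭.asIdeal : ℝ)⁻¹) ^ v I 𝔭]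
        conv_lhs => rw [← hprod I hI]
        simp [map_prod]
    _ = ∑ f ∈ A.image fun I ↦ fun (𝔭 : HeightOneSpectrum (𝓞 K)) (_ : 𝔭 ∈ S) ↦ v I 𝔭,
          ∏ 𝔭 ∈ S.attach, ((Ideal.absNorm 𝔭.1.asIdeal : ℝ)⁻¹) ^ f 𝔭.1 𝔭.2 := by
        rw [Finset.sum_image]
        intro I hI J hJ h
        rw [← hprod I hI, ← hprod J hJ]
        exact Finset.prod_congr rfl fun 𝔭 h𝔭 ↦ congrArg _ (congrFun (congrFun h 𝔭) h𝔭)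
    _ ≤ ∑ f ∈ S.pi fun _ ↦ Finset.range k,
          ∏ 𝔭 ∈ S.attach, ((Ideal.absNorm 𝔭.1.asIdeal : ℝ)⁻¹) ^ f 𝔭.1 𝔭.2 := by
        refine Finset.sum_le_sum_of_subset_of_nonneg ?_ fun _ _ _ ↦ by positivity
        intro f hf
        obtain ⟨I, hI, rfl⟩ := Finset.mem_image.1 hf
        rw [Finset.mem_pi]
        intro 𝔭 h𝔭
        rw [Finset.mem_range, Nat.lt_succ_iff]
        exact (Finset.le_sup (f := v I) h𝔭).trans (Finset.le_sup (f := fun I ↦ S.sup (v I)) hI)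
    _ = ∏ 𝔭 ∈ S, ∑ e ∈ Finset.range k, ((Ideal.absNorm 𝔭.asIdeal : ℝ)⁻¹) ^ e := by
        rw [Finset.prod_sum]
    _ ≤ _ := by
        refine Finset.prod_le_prod (fun _ _ ↦ by positivity) fun 𝔭 _ ↦ ?_
        have h1 : (1 : ℝ) < Ideal.absNorm 𝔭.asIdeal :=
          mod_cast NumberField.HeightOneSpectrum.one_lt_absNorm 𝔭
        rw [← tsum_geometric_of_lt_one (by positivity) (inv_lt_one_of_one_lt₀ h1)]
        exact (summable_geometric_of_lt_one (by positivity) (inv_lt_one_of_one_lt₀ h1)).sum_le_tsum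
          _ fun _ _ ↦ by positivity

theorem exists_prod_one_sub_absNorm_inv_lt {ε : ℝ} (hε : 0 < ε) :
    ∃ S : Finset (HeightOneSpectrum (𝓞 K)),
      ∏ 𝔭 ∈ S, (1 - (Ideal.absNorm 𝔭.asIdeal : ℝ)⁻¹) < ε := by
  classical
  by_contra! H
  refine not_summable_absNorm_inv K (summable_of_sum_le (c := ε⁻¹) (fun _ ↦ by positivity)
    fun A ↦ ?_)
  rw [← Finset.sum_erase (a := 0) A (by simp)]
  obtain ⟨S, hS⟩ := sum_absNorm_inv_le_prod K (A.erase 0) fun I hI ↦ (Finset.mem_erase.1 hI).1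
  refine hS.trans ?_
  rw [Finset.prod_inv_distrib]
  exact inv_anti₀ hε (H S)

end IdealSums

/-! ### Boxes in a free abelian group -/

section CoordBox

open Topology

variable {R : Type*} [AddCommGroup R] {n : ℕ}

/-- The elements all of whose coordinates in the basis `B` lie in `[a, b)`. -/
noncomputable def coordBox (B : Basis (Fin n) ℤ R) (a b : ℤ) : Finset R :=
  (Fintype.piFinset fun _ : Fin n ↦ Finset.Ico a b).map B.equivFun.symm.toEquiv.toEmbedding

variable {B : Basis (Fin n) ℤ R} {a b : ℤ}

theorem mem_coordBox {x : R} : x ∈ coordBox B a b ↔ ∀ i, a ≤ B.repr x i ∧ B.repr x i < b := by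
  simp only [coordBox, Finset.mem_map_equiv, Fintype.mem_piFinset, Finset.mem_Ico]
  rfl

theorem card_coordBox : (coordBox B a b).card = (b - a).toNat ^ n := by
  simp [coordBox]

open scoped Classical in
theorem card_coordBox_slice_mul_le (i : Fin n) (s : ℤ) :
    ((coordBox B a b).filter fun x ↦ B.repr x i = s).card * (b - a).toNat
      ≤ (coordBox B a b).card := by
  have h1 : ((coordBox B a b).filter fun x ↦ B.repr x i = s) ⊆
      (Fintype.piFinset (Function.update (fun _ ↦ Finset.Ico a b) i {s})).map
        B.equivFun.symm.toEquiv.toEmbedding := by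
    intro x hx
    rw [Finset.mem_filter, mem_coordBox] at hx
    rw [Finset.mem_map_equiv, Fintype.mem_piFinset]
    intro k
    rcases eq_or_ne k i with rfl | hk
    · simpa using hx.2
    · simpa [hk] using hx.1 k
  have h2 := Finset.card_le_card h1
  rw [Finset.card_map, Fintype.card_piFinset] at h2
  have h3 : (∏ k, (Function.update (fun _ : Fin n ↦ Finset.Ico a b) i {s} k).card)
      = (b - a).toNat ^ (n - 1) := by
    rw [← Finset.mul_prod_erase _ _ (Finset.mem_univ i),
      Finset.prod_congr rfl (g := fun _ ↦ (b - a).toNat)]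
    · simp
    · intro k hk
      simp [(Finset.mem_erase.1 hk).1]
  rw [h3] at h2
  have hn : n = n - 1 + 1 := by have := i.pos; omega
  rw [card_coordBox]
  conv_rhs => rw [hn, pow_succ]
  exact Nat.mul_le_mul_right _ h2

/-! ### Equidistribution of residues in boxes -/

section Equidistribution

variable {G : Type*} [AddCommGroup G] (π : R →+ G)

open scoped Classical in
theorem card_coordBox_fiber_le_add (i : Fin n) (g : G) (ε : ℤ) (hε : ε = 1 ∨ ε = -1) :
    ((coordBox B a b).filter fun x ↦ π x = g).card ≤
      ((coordBox B a b).filter fun x ↦ π x = g + π (ε • B i)).card +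
      ((coordBox B a b).filter fun x ↦ B.repr x i = if ε = 1 then b - 1 else a).card := by
  rw [← Finset.card_filter_add_card_filter_not (s := (coordBox B a b).filter fun x ↦ π x = g)
    fun x ↦ B.repr x i = if ε = 1 then b - 1 else a, add_comm]
  refine Nat.add_le_add ?_ (Finset.card_le_card (Finset.filter_subset_filter _
    (Finset.filter_subset _ _)))
  -- Translation by ε • B i leaves the box only from the face excluded here.
  refine Finset.card_le_card_of_injOn (· + ε • B i) (fun x hx ↦ ?_)
    (fun _ _ _ _ h ↦ add_right_cancel h)
  simp only [Finset.coe_filter, Finset.mem_filter, mem_coordBox, Set.mem_ofPred_eq] at hx ⊢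
  obtain ⟨⟨hx, hg⟩, hne⟩ := hx
  refine ⟨fun k ↦ ?_, by rw [map_add, hg]⟩
  have := hx k
  rcases eq_or_ne k i with rfl | hk
  · rcases hε with rfl | rfl <;> simp at hne ⊢ <;> omega
  · simpa [Finsupp.single_apply, hk.symm] using this

variable {α : Type*} {l : Filter α} {u v : α → ℤ}

open scoped Classical in
-- By additivity only basis vectors matter; for these the two fibres differ in size by at most one
-- face of the box, a proportion 1/L for side length L.
theorem tendsto_coordBox_fiber_sub (B : Basis (Fin n) ℤ R)
    (h : Tendsto (fun t ↦ (v t - u t).toNat) l atTop) (y : R) (g : G) :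
    Tendsto (fun t ↦
      (((coordBox B (u t) (v t)).filter fun x ↦ π x = g + π y).card : ℝ) /
          (coordBox B (u t) (v t)).card -
      (((coordBox B (u t) (v t)).filter fun x ↦ π x = g).card : ℝ) /
          (coordBox B (u t) (v t)).card) l (𝓝 0) := by
  have hy : y ∈ Submodule.span ℤ (Set.range B) := by simp [B.span_eq]
  have hinv : Tendsto (fun t ↦ (((v t - u t).toNat : ℝ))⁻¹) l (𝓝 0) :=
    tendsto_inv_atTop_zero.comp (tendsto_natCast_atTop_atTop.comp h)
  induction hy using Submodule.span_induction generalizing g with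
  | zero => simp [tendsto_const_nhds]
  | add x y _ _ hx hy =>
    refine ((hx g).add (hy (g + π x))).congr' ?_ |>.trans (by simp)
    refine Eventually.of_forall fun t ↦ ?_
    simp only [map_add, add_assoc]
    ring
  | smul k x _ hx =>
    induction k with
    | zero => simp [tendsto_const_nhds]
    | succ k ih =>
      refine (ih.add (hx (g + π ((k : ℤ) • x)))).congr' ?_ |>.trans (by simp)
      refine Eventually.of_forall fun t ↦ ?_
      simp only [add_smul, one_smul, map_add, add_assoc]
      ring
    | pred k ih =>
      refine (ih.sub (hx (g + π ((-(k : ℤ) - 1) • x)))).congr' ?_ |>.trans (by simp)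
      refine Eventually.of_forall fun t ↦ ?_
      simp only [add_assoc, ← map_add]
      rw [show (-(k : ℤ) - 1) • x + x = -(k : ℤ) • x by module]
      ring
  | mem x hx =>
    obtain ⟨i, rfl⟩ := hx
    refine squeeze_zero_norm' ?_ hinv
    filter_upwards [h.eventually_ge_atTop 1] with t ht
    have hL : (0 : ℝ) < ((v t - u t).toNat : ℝ) := by positivity
    have hN : (0 : ℝ) < ((coordBox B (u t) (v t)).card : ℝ) := by
      rw [card_coordBox]; push_cast; positivity
    have key (s : ℤ) : (((coordBox B (u t) (v t)).filter fun x ↦ B.repr x i = s).card : ℝ) ≤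
        (coordBox B (u t) (v t)).card * ((v t - u t).toNat : ℝ)⁻¹ := by
      rw [← div_eq_mul_inv, le_div_iff₀ hL]
      exact mod_cast card_coordBox_slice_mul_le i s
    have h1 := card_coordBox_fiber_le_add (B := B) (a := u t) (b := v t) π i g 1 (Or.inl rfl)
    -- Translating back from the fibre over g + π (B i) gives the reverse inequality.
    have h2 := card_coordBox_fiber_le_add (B := B) (a := u t) (b := v t) π i
      (g + π (B i)) (-1) (Or.inr rfl)
    have e : g + π (B i) + π ((-1 : ℤ) • B i) = g := by simp
    rw [e] at h2
    rw [one_smul] at h1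
    have h1' := (Nat.cast_le (α := ℝ)).2 h1
    have h2' := (Nat.cast_le (α := ℝ)).2 h2
    push_cast at h1' h2'
    rw [← sub_div, Real.norm_eq_abs, abs_div, abs_of_pos hN, div_le_iff₀ hN, abs_le]
    have k1 := key (v t - 1)
    have k2 := key (u t)
    constructor <;> linarith

open scoped Classical in
/-- The fibres of a surjection onto a finite group are equidistributed in large boxes. -/
theorem tendsto_coordBox_fiber (B : Basis (Fin n) ℤ R) [Finite G] (hπ : Function.Surjective π)
    (h : Tendsto (fun t ↦ (v t - u t).toNat) l atTop) (g : G) :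
    Tendsto (fun t ↦ (((coordBox B (u t) (v t)).filter fun x ↦ π x = g).card : ℝ) /
      (coordBox B (u t) (v t)).card) l (𝓝 (1 / Nat.card G)) := by
  have := Fintype.ofFinite G
  set f : G → α → ℝ := fun g t ↦
    (((coordBox B (u t) (v t)).filter fun x ↦ π x = g).card : ℝ) /
      (coordBox B (u t) (v t)).card with hf
  -- Since the fibre proportions sum to 1, this sum is 1 - |G| · f g t, which determines the limit
  -- of f g.
  have h1 : Tendsto (fun t ↦ ∑ g' : G, (f g' t - f g t)) l (𝓝 (∑ _ : G, 0)) := by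
    refine tendsto_finsetSum _ fun g' _ ↦ ?_
    obtain ⟨y, hy⟩ := hπ (g' - g)
    have := tendsto_coordBox_fiber_sub π B h y g
    rwa [hy, add_sub_cancel] at this
  have hG : (Nat.card G : ℝ) ≠ 0 := by simp
  rw [Finset.sum_const_zero] at h1
  have h2 := (tendsto_const_nhds (x := (1 : ℝ) / Nat.card G)).sub
    (h1.const_mul ((1 : ℝ) / Nat.card G))
  rw [mul_zero, sub_zero] at h2
  refine h2.congr' ?_
  filter_upwards [h.eventually_ge_atTop 1] with t ht
  have hN : (0 : ℝ) < ((coordBox B (u t) (v t)).card : ℝ) := by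
    rw [card_coordBox]; push_cast; positivity
  have hs : ∑ g' : G, f g' t = 1 := by
    simp only [hf]
    rw [← Finset.sum_div, div_eq_one_iff_eq hN.ne', ← Nat.cast_sum,
      ← Finset.card_eq_sum_card_fiberwise (f := π) (t := Finset.univ) fun _ _ ↦ by simp]
  rw [Finset.sum_sub_distrib, hs, Finset.sum_const, Finset.card_univ, ← Nat.card_eq_fintype_card,
    nsmul_eq_mul]
  change _ = f g t
  generalize f g t = w
  field_simp
  ring

end Equidistribution

open scoped Classical in
-- Cut the box into cells of side δ: two elements of I in one cell differ by an element of I with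
-- all coordinates below δ in absolute value, hence coincide.
theorem card_coordBox_filter_mem_le (I : AddSubgroup R) {δ : ℕ} (hδ : 0 < δ)
    (h : ∀ x ∈ I, (∀ i, |B.repr x i| < δ) → x = 0) :
    ((coordBox B a b).filter (· ∈ I)).card ≤ ((b - a).toNat / δ + 1) ^ n := by
  have : ((b - a).toNat / δ + 1) ^ n =
      (Fintype.piFinset fun _ : Fin n ↦ Finset.range ((b - a).toNat / δ + 1)).card := by simp
  rw [this]
  refine Finset.card_le_card_of_injOn (fun x i ↦ (B.repr x i - a).toNat / δ) ?_ ?_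
  · intro x hx
    simp only [Finset.coe_filter, mem_coordBox, Set.mem_ofPred_eq] at hx
    rw [Finset.mem_coe, Fintype.mem_piFinset]
    intro i
    have := hx.1 i
    rw [Finset.mem_range, Nat.lt_succ_iff]
    exact Nat.div_le_div_right (by omega)
  · intro x hx y hy hxy
    simp only [Finset.coe_filter, mem_coordBox, Set.mem_ofPred_eq] at hx hy
    refine sub_eq_zero.1 (h _ (I.sub_mem hx.2 hy.2) fun i ↦ ?_)
    have h1 := hx.1 i
    have h2 := hy.1 i
    have h3 : (B.repr x i - a).toNat / δ = (B.repr y i - a).toNat / δ := congrFun hxy i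
    have h4 := Nat.div_add_mod (B.repr x i - a).toNat δ
    have h5 := Nat.div_add_mod (B.repr y i - a).toNat δ
    have h6 := Nat.mod_lt (B.repr x i - a).toNat hδ
    have h7 := Nat.mod_lt (B.repr y i - a).toNat hδ
    rw [h3] at h4
    rw [map_sub, Finsupp.sub_apply, abs_lt]
    omega

end CoordBox

/-! ### Elements of an ideal in a box -/

section NumberFieldBox

variable {K : Type*} [Field K] [NumberField K]

theorem exists_natAbs_norm_le_mul_pow (B : Basis (Fin (finrank ℚ K)) ℤ (𝓞 K)) :
    ∃ A : ℕ, ∀ (x : 𝓞 K) (k : ℕ), (∀ i, |B.repr x i| ≤ k) →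
      (Algebra.norm ℤ x).natAbs ≤ A * k ^ finrank ℚ K := by
  let W (σ : K →ₐ[ℚ] ℂ) : ℝ := ∑ i, ‖σ (B i : K)‖
  refine ⟨⌈∏ σ, W σ⌉₊, fun x k hx ↦ ?_⟩
  have h1 (σ : K →ₐ[ℚ] ℂ) : ‖σ (x : K)‖ ≤ W σ * k := by
    have : (x : K) = ∑ i, (B.repr x i : K) * (B i : K) := by
      conv_lhs => rw [← B.sum_repr x]
      simp [map_sum]
    rw [this, map_sum, Finset.sum_mul]
    refine (norm_sum_le _ _).trans (Finset.sum_le_sum fun i _ ↦ ?_)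
    rw [map_mul, norm_mul, mul_comm, map_intCast]
    refine mul_le_mul_of_nonneg_left ?_ (norm_nonneg _)
    rw [Complex.norm_intCast]
    exact mod_cast hx i
  have h2 : ((Algebra.norm ℤ x).natAbs : ℝ) = ∏ σ : K →ₐ[ℚ] ℂ, ‖σ (x : K)‖ := by
    rw [← norm_prod, ← Algebra.norm_eq_prod_embeddings, ← Algebra.coe_norm_int]
    simp [Complex.norm_intCast, Nat.cast_natAbs]
  have h3 : ((Algebra.norm ℤ x).natAbs : ℝ) ≤ (⌈∏ σ, W σ⌉₊ : ℝ) * (k : ℝ) ^ finrank ℚ K := by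
    rw [h2]
    calc _ ≤ ∏ σ : K →ₐ[ℚ] ℂ, (W σ * k) :=
          Finset.prod_le_prod (fun _ _ ↦ norm_nonneg _) fun σ _ ↦ h1 σ
      _ = (∏ σ, W σ) * (k : ℝ) ^ finrank ℚ K := by
          rw [Finset.prod_mul_distrib, Finset.prod_const, Finset.card_univ, AlgHom.card]
      _ ≤ _ := by gcongr; exact Nat.le_ceil _
  exact_mod_cast h3

open scoped Classical in
/-- A box contains at most a constant times the expected number of elements of an ideal, unless it
contains no nonzero element of the ideal. -/
theorem exists_card_coordBox_filter_mem_ideal_le (B : Basis (Fin (finrank ℚ K)) ℤ (𝓞 K)) :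
    ∃ C : ℝ, 0 ≤ C ∧ ∀ (I : Ideal (𝓞 K)) (a b : ℤ), I ≠ ⊥ → a ≤ 0 → 0 ≤ b →
      (∃ x ∈ coordBox B a b, x ∈ I ∧ x ≠ 0) →
        (((coordBox B a b).filter (· ∈ I)).card : ℝ) ≤
          C * (coordBox B a b).card / Ideal.absNorm I := by
  obtain ⟨A, hA⟩ := exists_natAbs_norm_le_mul_pow B
  refine ⟨2 ^ finrank ℚ K * A, by positivity, fun I a b hI ha hb ⟨x, hx, hxI, hx0⟩ ↦ ?_⟩
  have hle {y : 𝓞 K} (hy : y ∈ I) (hy0 : y ≠ 0) (k : ℕ) (hk : ∀ i, |B.repr y i| ≤ k) :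
      Ideal.absNorm I ≤ A * k ^ finrank ℚ K := by
    refine (Nat.le_of_dvd ?_ (Int.natCast_dvd.1 (Ideal.absNorm_dvd_norm_of_mem hy))).trans
      (hA y k hk)
    exact Int.natAbs_pos.2 (Algebra.norm_ne_zero_iff.2 hy0)
  have hIpos : 0 < Ideal.absNorm I := by
    rwa [Nat.pos_iff_ne_zero, Ne, Ideal.absNorm_eq_zero_iff]
  set L := (b - a).toNat with hL
  have hIL : Ideal.absNorm I ≤ A * L ^ finrank ℚ K := by
    refine hle hxI hx0 L fun i ↦ ?_
    have := mem_coordBox.1 hx i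
    rw [abs_le]
    omega
  have hex : ∃ δ : ℕ, Ideal.absNorm I ≤ A * δ ^ finrank ℚ K := ⟨L, hIL⟩
  -- A nonzero y in I with coordinates at most k has N(I) ≤ |N(y)| ≤ A k^n. By minimality of δ, no
  -- nonzero element of I has all coordinates below δ.
  set δ := Nat.find hex with hδdef
  have hδ : Ideal.absNorm I ≤ A * δ ^ finrank ℚ K := Nat.find_spec hex
  have hδL : δ ≤ L := Nat.find_min' hex hIL
  have hδ0 : 0 < δ := by
    rw [Nat.pos_iff_ne_zero]
    intro h0
    rw [h0, zero_pow finrank_pos.ne', mul_zero] at hδ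
    omega
  have hcard := card_coordBox_filter_mem_le (B := B) (a := a) (b := b) I.toAddSubgroup hδ0
    fun y hy hlt ↦ by
      by_contra hy0
      refine Nat.find_min hex (m := δ - 1) (by omega) (hle hy hy0 _ fun i ↦ ?_)
      have := hlt i
      omega
  rw [card_coordBox, ← hL]
  have hδ' : (Ideal.absNorm I : ℝ) ≤ A * (δ : ℝ) ^ finrank ℚ K := mod_cast hδ
  have hIpos' : (0 : ℝ) < Ideal.absNorm I := mod_cast hIpos
  have hδ0' : (0 : ℝ) < δ := mod_cast hδ0
  push_cast
  calc (((coordBox B a b).filter (· ∈ I)).card : ℝ) ≤ ((L / δ : ℕ) + 1 : ℝ) ^ finrank ℚ K :=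
        mod_cast hcard
    -- The nonzero element of I in the box gives δ ≤ L, so the 1 is absorbed at the cost of a factor
    -- 2.
    _ ≤ (2 * (L / δ)) ^ finrank ℚ K := by
        have h1 : ((L / δ : ℕ) : ℝ) ≤ L / δ := Nat.cast_div_le
        have h2 : (1 : ℝ) ≤ L / δ := by
          rw [one_le_div hδ0']
          exact mod_cast hδL
        gcongr
        linarith
    _ ≤ _ := by
        rw [mul_pow, div_pow, mul_assoc, mul_div_assoc]
        refine mul_le_mul_of_nonneg_left ?_ (by positivity)
        rw [div_le_div_iff₀ (by positivity) hIpos']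
        calc (L : ℝ) ^ finrank ℚ K * Ideal.absNorm I
            ≤ L ^ finrank ℚ K * (A * (δ : ℝ) ^ finrank ℚ K) := by gcongr
          _ = _ := by ring

end NumberFieldBox

/-! ### Counting tuples by residues -/

section Counting

open Topology

open scoped Classical in
theorem card_filter_card_zeros_lt (G : Type*) [Fintype G] [Zero G] (m j : ℕ) :
    (Finset.univ.filter fun c : Fin m → G ↦ (Finset.univ.filter fun i ↦ c i = 0).card < j).card =
      ∑ k ∈ Finset.range j, m.choose k * (Fintype.card G - 1) ^ (m - k) := by
  have hfib (Z : Finset (Fin m)) :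
      (Finset.univ.filter fun c : Fin m → G ↦ (Finset.univ.filter fun i ↦ c i = 0) = Z).card =
        (Fintype.card G - 1) ^ (m - Z.card) := by
    have : (Finset.univ.filter fun c : Fin m → G ↦ (Finset.univ.filter fun i ↦ c i = 0) = Z) =
        Fintype.piFinset fun i ↦ if i ∈ Z then ({0} : Finset G) else Finset.univ.erase 0 := by
      ext c
      simp only [Finset.mem_filter, Finset.mem_univ, true_and, Fintype.mem_piFinset,
        Finset.ext_iff]
      refine forall_congr' fun i ↦ ?_
      by_cases h : i ∈ Z <;> simp [h]
    rw [this, Fintype.card_piFinset, ← Finset.prod_mul_prod_compl Z,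
      Finset.prod_congr rfl (g := fun _ ↦ 1) (fun i hi ↦ by simp [hi]),
      Finset.prod_congr rfl (s₁ := Zᶜ) (g := fun _ ↦ Fintype.card G - 1)
        (fun i hi ↦ by simp [Finset.mem_compl.1 hi])]
    simp [Finset.card_compl]
  rw [Finset.card_eq_sum_card_fiberwise
    (f := fun c : Fin m → G ↦ (Finset.univ.filter fun i ↦ c i = 0).card) (t := Finset.range j)
    (fun c hc ↦ by simpa using hc)]
  refine Finset.sum_congr rfl fun k hk ↦ ?_
  have hk := Finset.mem_range.1 hk
  rw [Finset.card_eq_sum_card_fiberwise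
    (f := fun c : Fin m → G ↦ Finset.univ.filter fun i ↦ c i = 0)
    (t := Finset.powersetCard k Finset.univ) (fun c hc ↦ by
      simp only [Finset.coe_filter, Finset.mem_filter, Set.mem_ofPred_eq] at hc
      simpa [Finset.mem_powersetCard] using hc.2),
    Finset.sum_congr rfl (g := fun _ ↦ (Fintype.card G - 1) ^ (m - k))]
  · simp
  · intro Z hZ
    have hZ := (Finset.mem_powersetCard.1 hZ).2
    rw [← hZ, ← hfib Z]
    congr 1
    ext c
    simp only [Finset.mem_filter, Finset.mem_univ, true_and, and_iff_right_iff_imp]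
    rintro rfl
    exact ⟨by omega, rfl⟩

open scoped Classical in
theorem card_card_zeros_lt_div (G : Type*) [Finite G] [Zero G] (m j : ℕ) :
    (Nat.card {c : Fin m → G // (Finset.univ.filter fun i ↦ c i = 0).card < j} : ℝ) /
        (Nat.card G : ℝ) ^ m =
      ∑ k ∈ Finset.range j, (m.choose k : ℝ) * (1 - 1 / (Nat.card G : ℝ)) ^ (m - k) *
        (1 / (Nat.card G : ℝ)) ^ k := by
  have := Fintype.ofFinite G
  have : Nonempty G := ⟨0⟩
  rw [Nat.card_eq_fintype_card, Fintype.card_subtype, card_filter_card_zeros_lt,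
    ← Nat.card_eq_fintype_card]
  have hG : 0 < Nat.card G := Nat.card_pos
  have hG' : (Nat.card G : ℝ) ≠ 0 := by positivity
  push_cast [Nat.cast_pred hG]
  rw [Finset.sum_div]
  refine Finset.sum_congr rfl fun k _ ↦ ?_
  rcases le_or_gt k m with hk | hk
  · rw [one_sub_div hG', div_pow, div_pow, one_pow, mul_div_assoc, mul_assoc, div_mul_div_comm,
      mul_one, ← pow_add, Nat.sub_add_cancel hk]
  -- For k > m the subtraction m - k truncates, but the binomial coefficient vanishes.
  · simp [Nat.choose_eq_zero_of_lt hk]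

/-- This is the source of the product over primes: conditions imposed separately at each p cut out a
product set once the indices are transposed. -/
theorem natCard_forall_comm {κ ι : Type*} [Fintype κ] {X : κ → Type*}
    (P : ∀ p, (ι → X p) → Prop) :
    Nat.card {c : ι → ∀ p, X p // ∀ p, P p fun i ↦ c i p} =
      ∏ p, Nat.card {d : ι → X p // P p d} := by
  rw [← Nat.card_pi]
  exact Nat.card_congr (((Equiv.piComm fun (_ : ι) p ↦ X p).subtypeEquiv fun c ↦ Iff.rfl).trans
    Equiv.subtypePiEquivPi)

variable {R G α : Type*} {m : ℕ} {l : Filter α}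

open scoped Classical in
/-- If the fibres of `π` are equidistributed in `Q t`, then any property of tuples depending only
on the images under `π` has the expected density. -/
theorem tendsto_piFinset_filter [Finite G] (Q : α → Finset R) (π : R → G)
    (h : ∀ g, Tendsto (fun t ↦ (((Q t).filter fun x ↦ π x = g).card : ℝ) / (Q t).card) l
      (𝓝 (1 / Nat.card G))) (P : (Fin m → G) → Prop) :
    Tendsto (fun t ↦ (((Fintype.piFinset fun _ : Fin m ↦ Q t).filter
        fun β ↦ P fun i ↦ π (β i)).card : ℝ) / ((Q t).card : ℝ) ^ m) l
      (𝓝 ((Nat.card {c // P c} : ℝ) / (Nat.card G : ℝ) ^ m)) := by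
  have := Fintype.ofFinite G
  -- The tuples with residue pattern c form a product of fibres; sum over the finitely many
  -- admissible c.
  have h1 : Tendsto (fun t ↦ ∑ c : {c // P c}, ∏ i : Fin m,
      ((((Q t).filter fun x ↦ π x = c.1 i).card : ℝ) / (Q t).card)) l
      (𝓝 (∑ _ : {c : Fin m → G // P c}, ∏ _ : Fin m, (1 / (Nat.card G : ℝ)))) :=
    tendsto_finsetSum _ fun c _ ↦ tendsto_finsetProd _ fun i _ ↦ h (c.1 i)
  have e : (∑ _ : {c : Fin m → G // P c}, ∏ _ : Fin m, (1 / (Nat.card G : ℝ))) =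
      (Nat.card {c // P c} : ℝ) / (Nat.card G : ℝ) ^ m := by
    simp [div_eq_mul_inv, Nat.card_eq_fintype_card]
  rw [e] at h1
  refine h1.congr fun t ↦ ?_
  rw [Finset.card_eq_sum_card_fiberwise (f := fun (β : Fin m → R) i ↦ π (β i))
    (t := Finset.univ.filter P) (fun β hβ ↦ by
      simp only [Finset.coe_filter, Finset.mem_univ, true_and, Set.mem_ofPred_eq] at hβ ⊢
      exact hβ.2), Nat.cast_sum, Finset.sum_div,
    ← Finset.sum_subtype (Finset.univ.filter P) (p := P) (by simp) (fun c ↦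
      ∏ i : Fin m, ((((Q t).filter fun x ↦ π x = c i).card : ℝ) / (Q t).card))]
  refine Finset.sum_congr rfl fun c hc ↦ ?_
  rw [Finset.prod_div_distrib, Finset.prod_const, Finset.card_univ, Fintype.card_fin,
    ← Nat.cast_prod, ← Fintype.card_piFinset]
  congr 3
  ext β
  simp only [Fintype.mem_piFinset, Finset.mem_filter, funext_iff]
  have hP := (Finset.mem_filter.1 hc).2
  constructor
  · intro hβ
    have : (fun i ↦ π (β i)) = c := funext fun i ↦ (hβ i).2
    exact ⟨⟨fun i ↦ (hβ i).1, this ▸ hP⟩, fun i ↦ (hβ i).2⟩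
  · exact fun hβ i ↦ ⟨hβ.1.1 i, hβ.2 i⟩

open scoped Classical in
theorem card_piFinset_filter_forall_mem_div (Q : Finset R) (hQ : Q.Nonempty) (p : R → Prop)
    (e : Finset (Fin m)) :
    (((Fintype.piFinset fun _ : Fin m ↦ Q).filter fun β ↦ ∀ i ∈ e, p (β i)).card : ℝ) /
        (Q.card : ℝ) ^ m = (((Q.filter p).card : ℝ) / Q.card) ^ e.card := by
  have : ((Fintype.piFinset fun _ : Fin m ↦ Q).filter fun β ↦ ∀ i ∈ e, p (β i)) =
      Fintype.piFinset fun i ↦ if i ∈ e then Q.filter p else Q := by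
    ext β
    simp only [Finset.mem_filter, Fintype.mem_piFinset, ← forall_and]
    refine forall_congr' fun i ↦ ?_
    by_cases h : i ∈ e <;> simp [h]
  have hQ' : (Q.card : ℝ) ≠ 0 := by simpa using hQ.ne_empty
  rw [this, Fintype.card_piFinset, ← Finset.prod_mul_prod_compl e,
    Finset.prod_congr rfl (g := fun _ ↦ (Q.filter p).card) (fun i hi ↦ by simp [hi]),
    Finset.prod_congr rfl (s₁ := eᶜ) (g := fun _ ↦ Q.card)
      (fun i hi ↦ by simp [Finset.mem_compl.1 hi])]
  simp only [Finset.prod_const, Finset.card_compl, Fintype.card_fin]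
  have hm : (Q.card : ℝ) ^ m = (Q.card : ℝ) ^ e.card * (Q.card : ℝ) ^ (m - e.card) := by
    rw [← pow_add, Nat.add_sub_cancel' (by simpa using e.card_le_univ)]
  rw [hm, div_pow]
  push_cast
  field_simp

end Counting

/-! ### Local conditions, the tail and the density -/

section JWise

open IsDedekindDomain Topology

variable {K : Type*} [Field K] [NumberField K] {r j m : ℕ}

open scoped Classical in
theorem jWiseRelativelyRPrime_iff {β : Fin m → 𝓞 K} :
    JWiseRelativelyRPrime j r β ↔ ∀ 𝔭 : HeightOneSpectrum (𝓞 K),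
      (Finset.univ.filter fun i ↦ β i ∈ 𝔭.asIdeal ^ r).card < j := by
  constructor
  · intro h 𝔭
    by_contra! hj
    obtain ⟨e, he, hej⟩ := Finset.exists_subset_card_eq hj
    refine h (e : Set (Fin m)) ?_ 𝔭.asIdeal 𝔭.isPrime ?_
    · simp [completeUniformHypergraph, hej]
    · rw [Ideal.dvd_iff_le, Ideal.span_le]
      rintro _ ⟨i, rfl⟩
      exact (Finset.mem_filter.1 (he i.2)).2
  · intro h e he 𝔭 h𝔭 hdvd
    -- The prime 𝔭 may be zero; enlarging it to a maximal ideal covers that case.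
    obtain ⟨𝔮, h𝔮⟩ : ∃ 𝔮 : HeightOneSpectrum (𝓞 K), 𝔭 ≤ 𝔮.asIdeal := by
      obtain ⟨M, hM, hle⟩ := 𝔭.exists_le_maximal h𝔭.ne_top
      exact ⟨⟨M, hM.isPrime, Ring.ne_bot_of_isMaximal_of_not_isField hM
        (RingOfIntegers.not_isField K)⟩, hle⟩
    rw [Ideal.dvd_iff_le, Ideal.span_le] at hdvd
    refine (h 𝔮).not_ge ?_
    have he : e.encard = j := he
    rw [← Nat.cast_le (α := ℕ∞), ← he, ← Set.encard_coe_eq_coe_finsetCard]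
    refine Set.encard_le_encard fun i hi ↦ ?_
    simpa using Ideal.pow_right_mono h𝔮 r (hdvd ⟨⟨i, hi⟩, rfl⟩)

theorem integralBox_eq (B : Basis (Fin (finrank ℚ K)) ℤ (𝓞 K)) (M : ℝ) :
    integralBox B M = coordBox B ⌈-M⌉ ⌈M⌉ := by
  ext x
  simp [integralBox, mem_coordBox, Int.ceil_le, Int.lt_ceil]

open scoped Classical in
theorem boxRatio_eq (B : Basis (Fin (finrank ℚ K)) ℤ (𝓞 K)) (T : Set (Fin m → 𝓞 K)) (M : ℝ) :
    boxRatio B T M = (((Fintype.piFinset fun _ : Fin m ↦ coordBox B ⌈-M⌉ ⌈M⌉).filter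
      (· ∈ T)).card : ℝ) / ((coordBox B ⌈-M⌉ ⌈M⌉).card : ℝ) ^ m := by
  have h : integralBoxTuples B m M =
      (Fintype.piFinset fun _ : Fin m ↦ coordBox B ⌈-M⌉ ⌈M⌉ : Finset (Fin m → 𝓞 K)) := by
    ext z
    simp [integralBoxTuples, integralBox_eq]
  rw [boxRatio, h, Set.ncard_coe_finset, Fintype.card_piFinset]
  congr 2
  · rw [← Set.ncard_coe_finset]
    congr 1
    ext z
    simp [and_comm]
  · simp

theorem tendsto_ceil_sub_ceil_neg :
    Tendsto (fun M : ℝ ↦ (⌈M⌉ - ⌈-M⌉).toNat) atTop atTop := by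
  refine tendsto_atTop_mono (f := fun M : ℝ ↦ ⌈M⌉₊) (fun M ↦ ?_) tendsto_nat_ceil_atTop
  rw [← Int.ceil_toNat]
  rcases le_or_gt M 0 with h | h
  · have : ⌈M⌉ ≤ 0 := Int.ceil_le.2 (by simpa)
    omega
  · have : ⌈-M⌉ ≤ 0 := Int.ceil_le.2 (by simp [h.le])
    omega

open scoped Classical in
-- The factor is the probability that a random tuple modulo 𝔭^r has fewer than j zero entries, so it
-- lies in [0, 1].
theorem localFactor_eq (𝔭 : HeightOneSpectrum (𝓞 K)) :
    localFactor r j m 𝔭 =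
      (Nat.card {c : Fin m → 𝓞 K ⧸ 𝔭.asIdeal ^ r //
        (Finset.univ.filter fun i ↦ c i = 0).card < j} : ℝ) /
          (Nat.card (𝓞 K ⧸ 𝔭.asIdeal ^ r) : ℝ) ^ m := by
  have : Finite (𝓞 K ⧸ 𝔭.asIdeal ^ r) :=
    Ideal.finiteQuotientOfFreeOfNeBot _ (pow_ne_zero _ 𝔭.ne_bot)
  rw [card_card_zeros_lt_div]
  rfl

theorem localFactor_nonneg (𝔭 : HeightOneSpectrum (𝓞 K)) : 0 ≤ localFactor r j m 𝔭 := by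
  rw [localFactor_eq]
  positivity

theorem localFactor_le_one (𝔭 : HeightOneSpectrum (𝓞 K)) : localFactor r j m 𝔭 ≤ 1 := by
  classical
  have : Finite (𝓞 K ⧸ 𝔭.asIdeal ^ r) :=
    Ideal.finiteQuotientOfFreeOfNeBot _ (pow_ne_zero _ 𝔭.ne_bot)
  rw [localFactor_eq]
  refine div_le_one_of_le₀ ?_ (by positivity)
  rw [← Nat.cast_pow, Nat.cast_le]
  have := Nat.card_le_card_of_injective (Subtype.val : {c : Fin m → 𝓞 K ⧸ 𝔭.asIdeal ^ r //
        (Finset.univ.filter fun i ↦ c i = 0).card < j} → _) Subtype.val_injective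
  rwa [Nat.card_fun, Nat.card_fin] at this

theorem antitone_prod_localFactor : Antitone fun S : Finset (HeightOneSpectrum (𝓞 K)) ↦
    ∏ 𝔭 ∈ S, localFactor r j m 𝔭 := fun _ _ h ↦
  Finset.prod_le_prod_of_subset_of_le_one h (fun _ _ ↦ localFactor_nonneg _)
    fun _ _ _ ↦ localFactor_le_one _

/-- Factors in [0, 1] make the finite products decrease along inclusion, so they converge to their
infimum. -/
theorem multipliable_localFactor :
    Multipliable fun 𝔭 : HeightOneSpectrum (𝓞 K) ↦ localFactor r j m 𝔭 :=
  ⟨_, tendsto_atTop_ciInf antitone_prod_localFactor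
    ⟨0, by rintro _ ⟨S, rfl⟩; exact Finset.prod_nonneg fun _ _ ↦ localFactor_nonneg _⟩⟩

theorem tendsto_prod_localFactor :
    Tendsto (fun S : Finset (HeightOneSpectrum (𝓞 K)) ↦ ∏ 𝔭 ∈ S, localFactor r j m 𝔭) atTop
      (𝓝 (∏' 𝔭 : HeightOneSpectrum (𝓞 K), localFactor r j m 𝔭)) :=
  multipliable_localFactor.hasProd

open scoped Classical in
/-- The local conditions at finitely many primes are independent. -/
theorem tendsto_boxRatio_finset (B : Basis (Fin (finrank ℚ K)) ℤ (𝓞 K))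
    (S : Finset (HeightOneSpectrum (𝓞 K))) :
    Tendsto (boxRatio B {β : Fin m → 𝓞 K | ∀ 𝔭 ∈ S,
      (Finset.univ.filter fun i ↦ β i ∈ 𝔭.asIdeal ^ r).card < j}) atTop
      (𝓝 (∏ 𝔭 ∈ S, localFactor r j m 𝔭)) := by
  have hfin (𝔭 : S) : Finite (𝓞 K ⧸ 𝔭.1.asIdeal ^ r) :=
    Ideal.finiteQuotientOfFreeOfNeBot _ (pow_ne_zero _ 𝔭.1.ne_bot)
  let π : 𝓞 K →+ ∀ 𝔭 : S, 𝓞 K ⧸ 𝔭.1.asIdeal ^ r :=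
    (RingHom.pi fun 𝔭 : S ↦ Ideal.Quotient.mk (𝔭.1.asIdeal ^ r)).toAddMonoidHom
  -- Chinese remainder theorem for powers of distinct maximal ideals.
  have hπ : Function.Surjective π := by
    intro x
    obtain ⟨y, hy⟩ := Ideal.pi_quotient_surjective (I := fun 𝔭 : S ↦ 𝔭.1.asIdeal ^ r)
      (fun 𝔭 𝔮 h ↦ IsCoprime.pow (Ideal.isCoprime_of_isMaximal fun e ↦
        h (Subtype.ext (HeightOneSpectrum.ext e)))) x
    exact ⟨y, funext hy⟩
  have h := tendsto_piFinset_filter (m := m) (fun M : ℝ ↦ coordBox B ⌈-M⌉ ⌈M⌉) π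
    (tendsto_coordBox_fiber π B hπ tendsto_ceil_sub_ceil_neg)
    (fun c ↦ ∀ 𝔭 : S, (Finset.univ.filter fun i ↦ c i 𝔭 = 0).card < j)
  rw [natCard_forall_comm (fun (𝔭 : S) (d : Fin m → 𝓞 K ⧸ 𝔭.1.asIdeal ^ r) ↦
    (Finset.univ.filter fun i ↦ d i = 0).card < j), Nat.card_pi, Nat.cast_prod, Nat.cast_prod,
    ← Finset.prod_pow, ← Finset.prod_div_distrib] at h
  simp only [← localFactor_eq] at h
  rw [Finset.prod_coe_sort S fun 𝔭 ↦ localFactor r j m 𝔭] at h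
  refine h.congr fun M ↦ ?_
  rw [boxRatio_eq]
  congr 3
  ext β
  have hmem (x : 𝓞 K) (𝔭 : S) : π x 𝔭 = 0 ↔ x ∈ 𝔭.1.asIdeal ^ r :=
    Ideal.Quotient.eq_zero_iff_mem
  simp only [hmem, Set.mem_ofPred_eq, Subtype.forall]

open scoped Classical in
/-- The proportion of tuples failing the local condition at some prime outside of `S`. -/
theorem exists_boxRatio_tail_le (B : Basis (Fin (finrank ℚ K)) ℤ (𝓞 K)) (hr : r ≠ 0)
    (hj : j ≠ 0) (hrj : 2 ≤ r * j) :
    ∃ C : ℝ, 0 ≤ C ∧ ∀ M : ℝ, 1 ≤ M → ∀ S : Finset (HeightOneSpectrum (𝓞 K)),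
      ∃ F : Finset (HeightOneSpectrum (𝓞 K)), Disjoint F S ∧
      boxRatio B {β : Fin m → 𝓞 K | ∃ 𝔭 ∉ S,
        j ≤ (Finset.univ.filter fun i ↦ β i ∈ 𝔭.asIdeal ^ r).card} M ≤
      C * (((coordBox B ⌈-M⌉ ⌈M⌉).card : ℝ)⁻¹ +
        ∑ 𝔭 ∈ F, ((Ideal.absNorm 𝔭.asIdeal : ℝ) ^ 2)⁻¹) := by
  obtain ⟨C, hC, hbox⟩ := exists_card_coordBox_filter_mem_ideal_le B
  refine ⟨m.choose j * (1 + C ^ j), by positivity, fun M hM S ↦ ?_⟩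
  set a := ⌈-M⌉ with ha
  set b := ⌈M⌉ with hb
  have ha0 : a ≤ 0 := Int.ceil_le.2 (by push_cast; linarith)
  have hb0 : 0 < b := Int.lt_ceil.2 (by push_cast; linarith)
  set Q := coordBox B a b with hQ
  have h0Q : (0 : 𝓞 K) ∈ Q := mem_coordBox.2 fun i ↦ by simp [ha0, hb0]
  have hQne : Q.Nonempty := ⟨0, h0Q⟩
  have hQpos : (0 : ℝ) < Q.card := by simpa using hQne
  have hQ1 : (1 : ℝ) ≤ Q.card := mod_cast hQne.card_pos
  -- Such a 𝔭 divides one of the finitely many nonzero elements of the box.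
  have hfinite : {𝔭 : HeightOneSpectrum (𝓞 K) |
      ∃ x ∈ Q, x ∈ 𝔭.asIdeal ^ r ∧ x ≠ 0}.Finite := by
    refine (Q.filter (· ≠ 0)).finite_toSet.biUnion (t := fun x ↦
      {𝔭 : HeightOneSpectrum (𝓞 K) | x ≠ 0 ∧ 𝔭.asIdeal ∣ Ideal.span {x}}) (fun x hx ↦ ?_)
      |>.subset ?_
    · have hx0 : x ≠ 0 := (Finset.mem_filter.1 hx).2
      refine (Ideal.finite_factors (I := Ideal.span {x}) (by simpa using hx0)).subset ?_
      exact fun 𝔭 h𝔭 ↦ h𝔭.2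
    · rintro 𝔭 ⟨x, hx, hx𝔭, hx0⟩
      simp only [Set.mem_iUnion]
      refine ⟨x, by simp [hx, hx0], hx0, ?_⟩
      rw [Ideal.dvd_span_singleton]
      exact Ideal.pow_le_self hr hx𝔭
  let F := hfinite.toFinset \ S
  refine ⟨F, Finset.sdiff_disjoint, ?_⟩
  obtain ⟨N, hNmem, hNcard⟩ : ∃ N : Finset (Fin m) → (𝓞 K → Prop) → Finset (Fin m → 𝓞 K),
      (∀ e p β, β ∈ N e p ↔ β ∈ (Fintype.piFinset fun _ : Fin m ↦ Q) ∧ ∀ i ∈ e, p (β i)) ∧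
      ∀ e p, ((N e p).card : ℝ) / (Q.card : ℝ) ^ m =
        (((Q.filter p).card : ℝ) / Q.card) ^ e.card :=
    ⟨fun e p ↦ (Fintype.piFinset fun _ : Fin m ↦ Q).filter fun β ↦ ∀ i ∈ e, p (β i),
      fun _ _ _ ↦ Finset.mem_filter,
      fun e p ↦ card_piFinset_filter_forall_mem_div Q hQne p e⟩
  -- Take j bad indices e. Either all entries on e vanish, an event independent of 𝔭 and so counted
  -- once for each e, or a nonzero entry puts 𝔭 in F.
  have hsub : ((Fintype.piFinset fun _ : Fin m ↦ Q).filter (· ∈ {β : Fin m → 𝓞 K | ∃ 𝔭 ∉ S,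
        j ≤ (Finset.univ.filter fun i ↦ β i ∈ 𝔭.asIdeal ^ r).card})) ⊆
      (Finset.powersetCard j Finset.univ).biUnion fun e ↦
        N e (· = 0) ∪ F.biUnion fun 𝔭 ↦ N e (· ∈ 𝔭.asIdeal ^ r) := by
    intro β hβ
    obtain ⟨hβQ, 𝔭, h𝔭S, hcard⟩ := Finset.mem_filter.1 hβ
    obtain ⟨e, he, hej⟩ := Finset.exists_subset_card_eq hcard
    have hmem : ∀ i ∈ e, β i ∈ 𝔭.asIdeal ^ r := fun i hi ↦ (Finset.mem_filter.1 (he hi)).2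
    rw [Finset.mem_biUnion]
    refine ⟨e, by simp [Finset.mem_powersetCard, hej], Finset.mem_union.2 ?_⟩
    by_cases hz : ∀ i ∈ e, β i = 0
    · exact Or.inl ((hNmem _ _ _).2 ⟨hβQ, hz⟩)
    · push Not at hz
      obtain ⟨i, hi, hi0⟩ := hz
      refine Or.inr (Finset.mem_biUnion.2 ⟨𝔭, Finset.mem_sdiff.2 ⟨?_, h𝔭S⟩,
        (hNmem _ _ _).2 ⟨hβQ, hmem⟩⟩)
      exact hfinite.mem_toFinset.2 ⟨β i, Fintype.mem_piFinset.1 hβQ i, hmem i hi, hi0⟩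
  have hcard := (Finset.card_le_card hsub).trans (Finset.card_biUnion_le.trans
    (Finset.sum_le_sum fun e _ ↦ (Finset.card_union_le _ _).trans
      (Nat.add_le_add_left Finset.card_biUnion_le _)))
  have hcard' := (Nat.cast_le (α := ℝ)).2 hcard
  push_cast at hcard'
  rw [boxRatio_eq]
  refine (div_le_div_of_nonneg_right hcard' (by positivity)).trans ?_
  rw [Finset.sum_div]
  have hterm : ∀ e ∈ Finset.powersetCard j (Finset.univ : Finset (Fin m)),
      (((N e (· = 0)).card : ℝ) + ∑ 𝔭 ∈ F, ((N e (· ∈ 𝔭.asIdeal ^ r)).card : ℝ)) /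
        (Q.card : ℝ) ^ m ≤ (1 + C ^ j) * ((Q.card : ℝ)⁻¹ +
          ∑ 𝔭 ∈ F, ((Ideal.absNorm 𝔭.asIdeal : ℝ) ^ 2)⁻¹) := by
    intro e he
    have hej : e.card = j := (Finset.mem_powersetCard.1 he).2
    rw [add_div, Finset.sum_div]
    have h1 : ((N e (· = 0)).card : ℝ) / (Q.card : ℝ) ^ m ≤ (Q.card : ℝ)⁻¹ := by
      rw [hNcard, hej]
      have : (Q.filter (· = 0)).card ≤ 1 := Finset.card_le_one.2 fun x hx y hy ↦ by
        rw [(Finset.mem_filter.1 hx).2, (Finset.mem_filter.1 hy).2]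
      have h2 : ((Q.filter (· = 0)).card : ℝ) / Q.card ≤ (Q.card : ℝ)⁻¹ := by
        rw [div_eq_mul_inv]
        exact mul_le_of_le_one_left (by positivity) (mod_cast this)
      exact (pow_le_of_le_one (by positivity) (h2.trans (inv_le_one_of_one_le₀ hQ1)) hj).trans h2
    have h2 : ∀ 𝔭 ∈ F, ((N e (· ∈ 𝔭.asIdeal ^ r)).card : ℝ) / (Q.card : ℝ) ^ m ≤
        C ^ j * ((Ideal.absNorm 𝔭.asIdeal : ℝ) ^ 2)⁻¹ := by
      intro 𝔭 h𝔭
      have hex := hfinite.mem_toFinset.1 (Finset.mem_sdiff.1 h𝔭).1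
      have hle := (hbox (𝔭.asIdeal ^ r) a b (pow_ne_zero _ 𝔭.ne_bot) ha0 hb0.le hex)
      have hN : (1 : ℝ) ≤ Ideal.absNorm 𝔭.asIdeal :=
        mod_cast (NumberField.HeightOneSpectrum.one_lt_absNorm 𝔭).le
      rw [hNcard, hej]
      have h3 : ((Q.filter (· ∈ 𝔭.asIdeal ^ r)).card : ℝ) / Q.card ≤
          C * ((Ideal.absNorm 𝔭.asIdeal : ℝ) ^ r)⁻¹ := by
        rw [div_le_iff₀ hQpos]
        refine hle.trans_eq ?_
        rw [map_pow, Nat.cast_pow]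
        ring
      refine (pow_le_pow_left₀ (by positivity) h3 j).trans ?_
      rw [mul_pow, inv_pow, ← pow_mul]
      refine mul_le_mul_of_nonneg_left (inv_anti₀ (by positivity) ?_) (by positivity)
      exact pow_le_pow_right₀ hN hrj
    refine (add_le_add h1 (Finset.sum_le_sum h2)).trans ?_
    rw [← Finset.mul_sum]
    have h4 : 0 ≤ ∑ 𝔭 ∈ F, ((Ideal.absNorm 𝔭.asIdeal : ℝ) ^ 2)⁻¹ :=
      Finset.sum_nonneg fun _ _ ↦ by positivity
    have h5 : 0 ≤ C ^ j * (Q.card : ℝ)⁻¹ := by positivity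
    nlinarith
  refine (Finset.sum_le_sum hterm).trans_eq ?_
  rw [Finset.sum_const, Finset.card_powersetCard, Finset.card_univ, Fintype.card_fin,
    nsmul_eq_mul, mul_assoc]

theorem boxRatio_nonneg (B : Basis (Fin (finrank ℚ K)) ℤ (𝓞 K)) (T : Set (Fin m → 𝓞 K)) (M : ℝ) :
    0 ≤ boxRatio B T M := by
  rw [boxRatio]
  positivity

theorem boxRatio_mono (B : Basis (Fin (finrank ℚ K)) ℤ (𝓞 K)) {T U : Set (Fin m → 𝓞 K)}
    (h : T ⊆ U) (M : ℝ) : boxRatio B T M ≤ boxRatio B U M := by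
  classical
  rw [boxRatio_eq, boxRatio_eq]
  gcongr

theorem boxRatio_le_add (B : Basis (Fin (finrank ℚ K)) ℤ (𝓞 K)) {T U V : Set (Fin m → 𝓞 K)}
    (h : T ⊆ U ∪ V) (M : ℝ) : boxRatio B T M ≤ boxRatio B U M + boxRatio B V M := by
  classical
  refine (boxRatio_mono B h M).trans ?_
  rw [boxRatio_eq, boxRatio_eq, boxRatio_eq, ← add_div]
  gcongr
  have := Finset.card_union_le
    ((Fintype.piFinset fun _ : Fin m ↦ coordBox B ⌈-M⌉ ⌈M⌉).filter (· ∈ U))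
    ((Fintype.piFinset fun _ : Fin m ↦ coordBox B ⌈-M⌉ ⌈M⌉).filter (· ∈ V))
  rw [← Finset.filter_or] at this
  simp only [Set.mem_union]
  exact_mod_cast this

theorem tprod_localFactor_le (S : Finset (HeightOneSpectrum (𝓞 K))) :
    ∏' 𝔭 : HeightOneSpectrum (𝓞 K), localFactor r j m 𝔭 ≤ ∏ 𝔭 ∈ S, localFactor r j m 𝔭 :=
  antitone_prod_localFactor.le_of_tendsto tendsto_prod_localFactor S

/-- Each factor is (1 - 1/N(𝔭))^m ≤ 1 - 1/N(𝔭), and finite products of the latter become arbitrarily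
small. -/
theorem tprod_localFactor_one_one (hm : m ≠ 0) :
    ∏' 𝔭 : HeightOneSpectrum (𝓞 K), localFactor 1 1 m 𝔭 = 0 := by
  refine le_antisymm (le_of_forall_gt_imp_ge_of_dense fun ε hε ↦ ?_)
    (ge_of_tendsto' tendsto_prod_localFactor fun S ↦
      Finset.prod_nonneg fun _ _ ↦ localFactor_nonneg _)
  obtain ⟨S, hS⟩ := exists_prod_one_sub_absNorm_inv_lt K hε
  refine (tprod_localFactor_le S).trans (le_trans ?_ hS.le)
  refine Finset.prod_le_prod (fun _ _ ↦ localFactor_nonneg _) fun 𝔭 _ ↦ ?_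
  have h1 : (1 : ℝ) ≤ Ideal.absNorm 𝔭.asIdeal :=
    mod_cast (NumberField.HeightOneSpectrum.one_lt_absNorm 𝔭).le
  have h2 := inv_le_one_of_one_le₀ h1
  have h3 : 0 ≤ (Ideal.absNorm 𝔭.asIdeal : ℝ)⁻¹ := by positivity
  simp only [localFactor, pow_one, Finset.range_one, Finset.sum_singleton, Nat.choose_zero_right,
    Nat.cast_one, one_mul, Nat.sub_zero, pow_zero, mul_one, one_div]
  exact pow_le_of_le_one (by linarith) (by linarith) hm

theorem tendsto_boxRatio_jWiseRelativelyRPrime (B : Basis (Fin (finrank ℚ K)) ℤ (𝓞 K))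
    (hr : r ≠ 0) (hj : j ≠ 0) (hm : m ≠ 0) :
    Tendsto (boxRatio B {β : Fin m → 𝓞 K | JWiseRelativelyRPrime j r β}) atTop
      (𝓝 (∏' 𝔭 : HeightOneSpectrum (𝓞 K), localFactor r j m 𝔭)) := by
  classical
  set T := {β : Fin m → 𝓞 K | JWiseRelativelyRPrime j r β} with hT
  set U := fun S : Finset (HeightOneSpectrum (𝓞 K)) ↦ {β : Fin m → 𝓞 K | ∀ 𝔭 ∈ S,
      (Finset.univ.filter fun i ↦ β i ∈ 𝔭.asIdeal ^ r).card < j} with hU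
  have hTU (S) : T ⊆ U S := fun β hβ 𝔭 _ ↦ jWiseRelativelyRPrime_iff.1 hβ 𝔭
  set d := ∏' 𝔭 : HeightOneSpectrum (𝓞 K), localFactor r j m 𝔭 with hd
  rw [tendsto_order]
  constructor
  · intro c hc
    by_cases hrj : 2 ≤ r * j
    · obtain ⟨C, hC, htail⟩ := exists_boxRatio_tail_le (m := m) B hr hj hrj
      have hsum : Summable fun 𝔭 : HeightOneSpectrum (𝓞 K) ↦
          ((Ideal.absNorm 𝔭.asIdeal : ℝ) ^ 2)⁻¹ :=
        (summable_absNorm_sq_inv K).comp_injective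
          (i := fun 𝔭 : HeightOneSpectrum (𝓞 K) ↦ 𝔭.asIdeal) fun _ _ ↦ HeightOneSpectrum.ext
      -- Half of the gap d - c pays for the convergence at S, the other half for the tail: one η
      -- bounds 1/|Q|, the other the sum over primes outside S.
      obtain ⟨η, hη, hηC⟩ : ∃ η > 0, C * (η + η) < (d - c) / 2 := by
        have : Tendsto (fun η : ℝ ↦ C * (η + η)) (𝓝[>] 0) (𝓝 (C * (0 + 0))) :=
          ((by fun_prop : Continuous fun η : ℝ ↦ C * (η + η)).tendsto 0).mono_left
            nhdsWithin_le_nhds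
        rw [add_zero, mul_zero] at this
        have h2 := (this.eventually_lt_const (half_pos (sub_pos.2 hc))).and self_mem_nhdsWithin
        obtain ⟨η, h⟩ := h2.exists
        exact ⟨η, h.2, h.1⟩
      obtain ⟨S, hS⟩ := summable_iff_vanishing_norm.1 hsum η hη
      have hQ : Tendsto (fun M : ℝ ↦ ((coordBox B ⌈-M⌉ ⌈M⌉).card : ℝ)⁻¹) atTop (𝓝 0) := by
        refine tendsto_inv_atTop_zero.comp (tendsto_natCast_atTop_atTop.comp ?_)
        simp only [card_coordBox]
        exact (tendsto_pow_atTop finrank_pos.ne').comp tendsto_ceil_sub_ceil_neg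
      have hlow := (tendsto_boxRatio_finset (r := r) (j := j) (m := m) B S).eventually_const_lt
        (show d - (d - c) / 2 < _ by
          have := tprod_localFactor_le (r := r) (j := j) (m := m) S
          linarith)
      filter_upwards [hlow, hQ.eventually_lt_const hη, eventually_ge_atTop 1] with M h1 h2 h3
      obtain ⟨F, hFS, hF⟩ := htail M h3 S
      have h4 := (Real.le_norm_self _).trans (hS F hFS).le
      have h5 : U S ⊆ T ∪ {β : Fin m → 𝓞 K | ∃ 𝔭 ∉ S,
          j ≤ (Finset.univ.filter fun i ↦ β i ∈ 𝔭.asIdeal ^ r).card} := by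
        intro β hβ
        by_contra hcon
        rw [Set.mem_union, not_or] at hcon
        refine hcon.1 (jWiseRelativelyRPrime_iff.2 fun 𝔭 ↦ ?_)
        by_cases h𝔭 : 𝔭 ∈ S
        · exact hβ 𝔭 h𝔭
        · by_contra! hge
          exact hcon.2 ⟨𝔭, h𝔭, hge⟩
      have h6 := boxRatio_le_add B h5 M
      have h7 : C * (((coordBox B ⌈-M⌉ ⌈M⌉).card : ℝ)⁻¹ +
          ∑ 𝔭 ∈ F, ((Ideal.absNorm 𝔭.asIdeal : ℝ) ^ 2)⁻¹) ≤ C * (η + η) := by gcongr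
      linarith
    · have h1 : r * j = 1 := by
        have : r * j ≠ 0 := mul_ne_zero hr hj
        omega
      obtain ⟨rfl, rfl⟩ := mul_eq_one.1 h1
      rw [hd, tprod_localFactor_one_one hm] at hc
      exact Eventually.of_forall fun M ↦ hc.trans_le (boxRatio_nonneg B T M)
  · intro c hc
    obtain ⟨S, hS⟩ := (tendsto_prod_localFactor.eventually_lt_const hc).exists
    filter_upwards [(tendsto_boxRatio_finset B S).eventually_lt_const hS] with M hM
    exact (boxRatio_mono B (hTU S) M).trans_lt hM

end JWise

/-- The infinite product over all nonzero prime ideals converges unconditionally (possibly to `0`),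
and its value is the density of the set of `j`-wise relatively `r`-prime `m`-tuples. -/
theorem corollary2p5 (K : Type*) [Field K] [NumberField K] (r j m : ℕ)
    (hj : 1 ≤ j) (hjm : j ≤ m) (hrm : 2 ≤ r * m) :
    Multipliable (fun 𝔭 : IsDedekindDomain.HeightOneSpectrum (𝓞 K) => localFactor r j m 𝔭) ∧
      HasDensity {β : Fin m → 𝓞 K | JWiseRelativelyRPrime j r β}
        (∏' 𝔭 : IsDedekindDomain.HeightOneSpectrum (𝓞 K), localFactor r j m 𝔭) := by
  have hr : r ≠ 0 := by rintro rfl; omega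
  refine ⟨multipliable_localFactor, fun B ↦ ?_⟩
  have h := tendsto_boxRatio_jWiseRelativelyRPrime B hr (by omega : j ≠ 0) (by omega : m ≠ 0)
  exact ⟨h.limsup_eq, h.liminf_eq⟩
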